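/- Let $1<q<\infty$. Let $H^q$ be the Hardy space of holomorphic functions $g$ on the open unit disc $\mathbb{D}$ with $$\|g\|_q:=\Big(\sup_{0<r<1}\frac1{2\pi}\int_0^{2\pi}|g(re^{i\theta})|^q\,d\theta\Big)^{1/q}<\infty .$$ Let $\{a_k\}_{k=1}^\infty$ be a sequence of distinct points of $\mathbb{D}\setminus\{0\}$, and let $n>m\ge 0$ be integers. Then the two suprema below, taken over all $g\in H^q$ with $\|g\|_q=1$, are finite, and $$\sup_{\|g\|_q=1}\left|\sum_{j=1}^m g(a_j)\,\frac{\prod_{k=1}^m(1-\overline{a_k}a_j)}{\prod_{k=1,\,k\ne j}^m(a_k-a_j)}\right|<\sup_{\|g\|_q=1}\left|\sum_{j=1}^n g(a_j)\,\frac{\prod_{k=1}^n(1-\overline{a_k}a_j)}{\prod_{k=1,\,k\ne j}^n(a_k-a_j)}\right| ,$$ where empty products are $1$ and empty sums are $0$. -/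

import Mathlib

noncomputable section

/-- The `q`-th integral means `(1/2π) ∫₀^{2π} |g(r e^{iθ})|^q dθ` of `g` over the circles
of radius `0 < r < 1` centred at the origin. -/
def hardyMeans (q : ℝ) (g : ℂ → ℂ) : Set ℝ :=
  {x | ∃ r : ℝ, 0 < r ∧ r < 1 ∧
    x = (2 * Real.pi)⁻¹ *
      ∫ θ in (0 : ℝ)..(2 * Real.pi), ‖g ((r : ℂ) * Complex.exp ((θ : ℂ) * Complex.I))‖ ^ q}

/-- `g` belongs to the Hardy space `H^q` of the open unit disc (`0 < q < ∞`): it is holomorphic on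
the disc and its integral means are bounded. Values of `g` outside the disc play no role. -/
def MemHardy (q : ℝ) (g : ℂ → ℂ) : Prop :=
  DifferentiableOn ℂ g (Metric.ball (0 : ℂ) 1) ∧ BddAbove (hardyMeans q g)

/-- The norm of `H^q`: the `q`-th root of the supremum of the integral means. It is used only for
functions satisfying `MemHardy q`, for which this supremum is a genuine one. -/
def hardyNorm (q : ℝ) (g : ℂ → ℂ) : ℝ :=
  (sSup (hardyMeans q g)) ^ (1 / q)

/-- The sum `∑ⱼ g(aⱼ) · ∏ₖ (1 - conj(aₖ) aⱼ) / ∏_{k ≠ j} (aₖ - aⱼ)`, where `j` and `k` run over the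
first `m` points `a 0, …, a (m - 1)` of the sequence. -/
def dualSum (a : ℕ → ℂ) (m : ℕ) (g : ℂ → ℂ) : ℂ :=
  ∑ j ∈ Finset.range m, g (a j) *
    ((∏ k ∈ Finset.range m, (1 - (starRingEnd ℂ) (a k) * a j)) /
      (∏ k ∈ (Finset.range m).erase j, (a k - a j)))

/-- The absolute values of the above sum, as `g` runs over the unit sphere of `H^q`. -/
def dualValues (q : ℝ) (a : ℕ → ℂ) (m : ℕ) : Set ℝ :=
  {x | ∃ g : ℂ → ℂ, MemHardy q g ∧ hardyNorm q g = 1 ∧ x = ‖dualSum a m g‖}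

end

section

open Real Metric Complex

/-- A real function continuous on the unit circle is circle integrable. -/
lemma circleIntegrable_of_continuousOn_sphere {E : Type*} [NormedAddCommGroup E]
    {f : ℂ → E} (hf : ContinuousOn f (sphere 0 1)) : CircleIntegrable f 0 1 :=
  hf.circleIntegrable zero_le_one

lemma norm_circleAverage_le {E : Type*} [NormedAddCommGroup E] [NormedSpace ℝ E]
    (f : ℂ → E) (c : ℂ) (R : ℝ) :
    ‖circleAverage f c R‖ ≤ circleAverage (fun z ↦ ‖f z‖) c R := by
  rw [circleAverage, circleAverage, norm_smul, smul_eq_mul, Real.norm_of_nonneg (by positivity)]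
  gcongr
  exact intervalIntegral.norm_integral_le_integral_norm two_pi_pos.le

lemma DiffContOnCl.continuousOn_sphere {f : ℂ → ℂ} (hf : DiffContOnCl ℂ f (ball 0 1)) :
    ContinuousOn f (sphere 0 1) :=
  hf.continuousOn_ball.mono sphere_subset_closedBall

lemma ContinuousOn.norm_rpow {f : ℂ → ℂ} {s : Set ℂ} (hf : ContinuousOn f s) {q : ℝ}
    (hq : 0 ≤ q) : ContinuousOn (fun z ↦ ‖f z‖ ^ q) s :=
  hf.norm.rpow_const fun _ _ ↦ Or.inr hq

lemma continuousOn_poissonKernel {w : ℂ} (hw : ‖w‖ < 1) :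
    ContinuousOn (poissonKernel 0 w) (sphere 0 1) := by
  unfold poissonKernel
  refine ContinuousOn.div (by fun_prop) (by fun_prop) fun z hz ↦ ?_
  have hz : ‖z‖ = 1 := by simpa using hz
  have : z - w ≠ 0 := fun h ↦ by
    rw [sub_eq_zero] at h; rw [← h, hz] at hw; exact lt_irrefl _ hw
  simpa using this

lemma poissonKernel_le {w z : ℂ} (hw : ‖w‖ < 1) (hz : ‖z‖ = 1) :
    poissonKernel 0 w z ≤ (1 + ‖w‖) / (1 - ‖w‖) := by
  have := re_herglotzRieszKernel_le (c := 0) (R := 1) (z := z) (w := w) (by simpa) (by simpa)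
  simpa [poissonKernel_eq_re_herglotzRieszKernel, herglotzRieszKernel] using this

lemma le_poissonKernel {w z : ℂ} (hw : ‖w‖ < 1) (hz : ‖z‖ = 1) :
    (1 - ‖w‖) / (1 + ‖w‖) ≤ poissonKernel 0 w z := by
  have := le_re_herglotzRieszKernel (c := 0) (R := 1) (z := z) (w := w) (by simpa) (by simpa)
  simpa [poissonKernel_eq_re_herglotzRieszKernel, herglotzRieszKernel] using this

lemma poissonKernel_nonneg {w z : ℂ} (hw : ‖w‖ < 1) (hz : ‖z‖ = 1) :
    0 ≤ poissonKernel 0 w z :=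
  le_trans (div_nonneg (by linarith) (by positivity)) (le_poissonKernel hw hz)

lemma circleAverage_poissonKernel {w : ℂ} (hw : ‖w‖ < 1) :
    circleAverage (poissonKernel 0 w) 0 1 = 1 := by
  have h := (diffContOnCl_const (𝕜 := ℂ) (c := (1 : ℂ))
    (s := ball (0 : ℂ) 1)).circleAverage_poissonKernel_smul (w := w) (by simpa)
  have h2 := Complex.ofRealCLM.circleAverage_comp_comm
    (circleIntegrable_of_continuousOn_sphere (continuousOn_poissonKernel hw))
  have h3 : (poissonKernel 0 w • fun _ ↦ (1 : ℂ)) = Complex.ofRealCLM ∘ poissonKernel 0 w := by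
    ext z; simp
  rw [h3, h2, ofRealCLM_apply] at h
  exact_mod_cast h

/-- Jensen's inequality for the Poisson integral of a holomorphic function. -/
lemma norm_rpow_le_circleAverage_poissonKernel {q : ℝ} (hq : 1 < q) {f : ℂ → ℂ}
    (hf : DiffContOnCl ℂ f (ball 0 1)) {w : ℂ} (hw : ‖w‖ < 1) :
    ‖f w‖ ^ q ≤ circleAverage (fun z ↦ poissonKernel 0 w z * ‖f z‖ ^ q) 0 1 := by
  have hq0 : 0 < q := by linarith
  have hpq := Real.HolderConjugate.conjExponent hq
  set p := q.conjExponent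
  set c := ‖f w‖
  have hc : 0 ≤ c := norm_nonneg _
  set J := circleAverage (fun z ↦ poissonKernel 0 w z * ‖f z‖ ^ q) 0 1
  have hP := continuousOn_poissonKernel hw
  have hfc := hf.continuousOn_sphere
  have i1 : CircleIntegrable (fun z ↦ poissonKernel 0 w z * ‖f z‖ ^ q) 0 1 :=
    circleIntegrable_of_continuousOn_sphere (hP.mul (hfc.norm_rpow hq0.le))
  have i2 := circleIntegrable_of_continuousOn_sphere hP
  have h1 : c ≤ circleAverage (fun z ↦ poissonKernel 0 w z * ‖f z‖) 0 1 := by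
    have h := norm_circleAverage_le (poissonKernel 0 w • f) 0 1
    rw [hf.circleAverage_poissonKernel_smul (by simpa)] at h
    refine h.trans (le_of_eq (circleAverage_congr_sphere fun z hz ↦ ?_))
    have hz : ‖z‖ = 1 := by simpa using hz
    simp [abs_of_nonneg (poissonKernel_nonneg hw hz)]
  have hcq : c ^ (q - 1) * c = c ^ q := by
    rcases hc.eq_or_lt with h | h
    · rw [← h, mul_zero, Real.zero_rpow hq0.ne']
    · rw [← Real.rpow_add_one h.ne', sub_add_cancel]
  have hcp : (c ^ (q - 1)) ^ p = c ^ q := by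
    rw [← Real.rpow_mul hc, hpq.sub_one_mul_conj]
  have h2 : c ^ (q - 1) * circleAverage (fun z ↦ poissonKernel 0 w z * ‖f z‖) 0 1
      ≤ q⁻¹ * J + c ^ q / p * circleAverage (poissonKernel 0 w) 0 1 := by
    rw [← smul_eq_mul, ← smul_eq_mul, ← smul_eq_mul,
      ← circleAverage_smul, ← circleAverage_smul, ← circleAverage_smul, ← circleAverage_add
        (i1.const_smul) (i2.const_smul)]
    refine circleAverage_mono
      ((circleIntegrable_of_continuousOn_sphere (hP.mul hfc.norm)).const_smul)
      ((i1.const_smul).add (i2.const_smul)) fun z hz ↦ ?_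
    have hz : ‖z‖ = 1 := by simpa using hz
    have hy := Real.young_inequality_of_nonneg (norm_nonneg (f z))
      (Real.rpow_nonneg hc (q - 1)) hpq
    rw [hcp] at hy
    have := mul_le_mul_of_nonneg_left hy (poissonKernel_nonneg hw hz)
    simp only [Pi.smul_apply, Pi.add_apply, smul_eq_mul]
    calc _ = poissonKernel 0 w z * (‖f z‖ * c ^ (q - 1)) := by ring
      _ ≤ _ := this
      _ = _ := by ring
  have h3 : c ^ q ≤ q⁻¹ * J + c ^ q / p := by
    calc c ^ q = c ^ (q - 1) * c := hcq.symm
      _ ≤ c ^ (q - 1) * _ := mul_le_mul_of_nonneg_left h1 (Real.rpow_nonneg hc _)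
      _ ≤ _ := by rwa [circleAverage_poissonKernel hw, mul_one] at h2
  have h4 := hpq.inv_add_inv_eq_one
  have h5 : c ^ q * (q⁻¹ + p⁻¹) ≤ q⁻¹ * J + c ^ q / p := by rwa [h4, mul_one]
  have h6 : q⁻¹ * c ^ q ≤ q⁻¹ * J := by
    have : c ^ q * (q⁻¹ + p⁻¹) = q⁻¹ * c ^ q + c ^ q / p := by ring
    linarith
  exact le_of_mul_le_mul_left h6 (by positivity)

lemma poissonKernel_circleMap_swap (r s t : ℝ) :
    poissonKernel 0 (circleMap 0 r s) (circleMap 0 1 t) =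
      poissonKernel 0 (circleMap 0 r t) (circleMap 0 1 s) := by
  simp only [poissonKernel, sub_zero, norm_circleMap_zero]
  congr 2
  have key : ∀ s t : ℝ, ‖circleMap 0 1 t - circleMap 0 r s‖ = ‖1 - circleMap 0 r (s - t)‖ := by
    intro s t
    have : circleMap 0 1 t - circleMap 0 r s = circleMap 0 1 t * (1 - circleMap 0 r (s - t)) := by
      simp only [circleMap, zero_add, ofReal_one, one_mul, mul_sub, mul_one]
      congr 1
      rw [mul_left_comm, ← Complex.exp_add]
      push_cast; ring_nf
    rw [this, norm_mul, norm_circleMap_zero, abs_one, one_mul]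
  rw [key, key]
  have : 1 - circleMap 0 r (t - s) = (starRingEnd ℂ) (1 - circleMap 0 r (s - t)) := by
    simp only [circleMap, zero_add, map_sub, map_one, map_mul, conj_ofReal, ← Complex.exp_conj,
      conj_I]
    push_cast; ring_nf
  rw [this, RCLike.norm_conj]

/-- The integral means of a holomorphic function are at most its mean on the unit circle. -/
lemma circleAverage_norm_rpow_le {q : ℝ} (hq : 1 < q) {f : ℂ → ℂ}
    (hf : DiffContOnCl ℂ f (ball 0 1)) {r : ℝ} (hr0 : 0 < r) (hr : r < 1) :
    circleAverage (fun z ↦ ‖f z‖ ^ q) 0 r ≤ circleAverage (fun z ↦ ‖f z‖ ^ q) 0 1 := by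
  have hq0 : 0 ≤ q := by linarith
  have hnr : ∀ s, ‖circleMap 0 r s‖ < 1 := fun s ↦ by
    simpa [norm_circleMap_zero, abs_of_pos hr0] using hr
  set F : ℝ → ℝ → ℝ := fun s t ↦
    poissonKernel 0 (circleMap 0 r s) (circleMap 0 1 t) * ‖f (circleMap 0 1 t)‖ ^ q with hF
  have hfc : Continuous fun t ↦ ‖f (circleMap 0 1 t)‖ ^ q :=
    (hf.continuousOn_sphere.norm_rpow hq0).comp_continuous (continuous_circleMap 0 1)
      fun t ↦ circleMap_mem_sphere 0 zero_le_one t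
  have hPc : Continuous fun x : ℝ × ℝ ↦
      poissonKernel 0 (circleMap 0 r x.1) (circleMap 0 1 x.2) := by
    unfold poissonKernel
    refine Continuous.div (by fun_prop) (by fun_prop) fun x ↦ ?_
    have : circleMap 0 1 x.2 - circleMap 0 r x.1 ≠ 0 := fun h ↦ by
      have h1 := hnr x.1
      rw [← sub_eq_zero.1 h, norm_circleMap_zero, abs_one] at h1
      exact lt_irrefl _ h1
    simpa using this
  have hFc : Continuous (Function.uncurry F) := hPc.mul (hfc.comp continuous_snd)
  have hswap : ∫ s in (0 : ℝ)..2 * π, ∫ t in (0 : ℝ)..2 * π, F s t =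
      ∫ t in (0 : ℝ)..2 * π, ∫ s in (0 : ℝ)..2 * π, F s t :=
    MeasureTheory.intervalIntegral_intervalIntegral_swap
      ((hFc.continuousOn.integrableOn_compact
        (isCompact_uIcc.prod isCompact_uIcc)).mono_set
          (Set.prod_mono Set.uIoc_subset_uIcc Set.uIoc_subset_uIcc))
  have hin : ∀ t, (2 * π)⁻¹ * ∫ s in (0 : ℝ)..2 * π, F s t = ‖f (circleMap 0 1 t)‖ ^ q := by
    intro t
    have h := circleAverage_poissonKernel (hnr t)
    rw [circleAverage, smul_eq_mul] at h
    simp only [hF, intervalIntegral.integral_mul_const, ← mul_assoc,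
      poissonKernel_circleMap_swap r _ t]
    rw [h, one_mul]
  calc circleAverage (fun z ↦ ‖f z‖ ^ q) 0 r
      ≤ (2 * π)⁻¹ * ∫ s in (0 : ℝ)..2 * π, (2 * π)⁻¹ * ∫ t in (0 : ℝ)..2 * π, F s t := by
        rw [circleAverage, smul_eq_mul]
        gcongr
        refine intervalIntegral.integral_mono_on two_pi_pos.le ?_ ?_ fun s _ ↦ ?_
        · refine Continuous.intervalIntegrable ?_ _ _
          exact (hf.1.continuousOn.norm_rpow hq0).comp_continuous (continuous_circleMap 0 r)
            fun t ↦ by simpa using hnr t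
        · refine Continuous.intervalIntegrable (continuous_const.mul ?_) _ _
          exact intervalIntegral.continuous_parametric_intervalIntegral_of_continuous' hFc _ _
        · exact norm_rpow_le_circleAverage_poissonKernel hq hf (hnr s)
    _ = (2 * π)⁻¹ * ∫ t in (0 : ℝ)..2 * π, (2 * π)⁻¹ * ∫ s in (0 : ℝ)..2 * π, F s t := by
        rw [intervalIntegral.integral_const_mul, intervalIntegral.integral_const_mul, hswap]
    _ = _ := by simp only [hin]; rfl

/-- The finite Blaschke product with zeros `a 0, …, a (m - 1)`. -/
noncomputable def blaschke (a : ℕ → ℂ) (m : ℕ) (z : ℂ) : ℂ :=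
  ∏ k ∈ Finset.range m, (a k - z) / (1 - (starRingEnd ℂ) (a k) * z)

lemma one_sub_conj_mul_ne_zero {a z : ℂ} (ha : ‖a‖ < 1) (hz : ‖z‖ ≤ 1) :
    1 - (starRingEnd ℂ) a * z ≠ 0 := by
  intro h
  have h1 : (starRingEnd ℂ) a * z = 1 := (sub_eq_zero.1 h).symm
  have h2 : ‖a‖ * ‖z‖ = 1 := by simpa using congrArg norm h1
  nlinarith [norm_nonneg a, norm_nonneg z]

lemma sub_ne_zero_of_norm_lt {a z : ℂ} (ha : ‖a‖ < 1) (hz : ‖z‖ = 1) : a - z ≠ 0 := fun h ↦ by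
  rw [sub_eq_zero.1 h, hz] at ha; exact lt_irrefl _ ha

lemma blaschke_succ (a : ℕ → ℂ) (m : ℕ) (z : ℂ) : blaschke a (m + 1) z =
    blaschke a m z * ((a m - z) / (1 - (starRingEnd ℂ) (a m) * z)) :=
  Finset.prod_range_succ _ _

lemma norm_blaschke {a : ℕ → ℂ} (ha : ∀ k, ‖a k‖ < 1) (m : ℕ) {z : ℂ} (hz : ‖z‖ = 1) :
    ‖blaschke a m z‖ = 1 := by
  rw [blaschke, norm_prod]
  refine Finset.prod_eq_one fun k _ ↦ ?_
  have h0 := one_sub_conj_mul_ne_zero (ha k) hz.le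
  have hzz : z * (starRingEnd ℂ) z = 1 := by
    rw [Complex.mul_conj, Complex.normSq_eq_norm_sq, hz]; norm_num
  have h1 : 1 - (starRingEnd ℂ) (a k) * z = z * (starRingEnd ℂ) (z - a k) := by
    rw [map_sub, mul_sub, hzz]; ring
  rw [norm_div, div_eq_one_iff_eq (norm_ne_zero_iff.2 h0), h1, norm_mul, hz, one_mul,
    RCLike.norm_conj, norm_sub_rev]

lemma blaschke_ne_zero {a : ℕ → ℂ} (ha : ∀ k, ‖a k‖ < 1) (m : ℕ) {z : ℂ} (hz : ‖z‖ = 1) :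
    blaschke a m z ≠ 0 := by
  rw [← norm_ne_zero_iff, norm_blaschke ha m hz]; exact one_ne_zero

lemma blaschke_zero_ne_zero {a : ℕ → ℂ} (ha : ∀ k, a k ≠ 0) (m : ℕ) : blaschke a m 0 ≠ 0 := by
  simp [blaschke, Finset.prod_ne_zero_iff, ha]

lemma diffContOnCl_of_differentiableOn {f : ℂ → ℂ} (hf : DifferentiableOn ℂ f (closedBall 0 1)) :
    DiffContOnCl ℂ f (ball 0 1) :=
  DifferentiableOn.diffContOnCl (by rwa [closure_ball _ one_ne_zero])

lemma differentiableOn_blaschke {a : ℕ → ℂ} (ha : ∀ k, ‖a k‖ < 1) (m : ℕ) :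
    DifferentiableOn ℂ (blaschke a m) (closedBall 0 1) := by
  unfold blaschke
  refine DifferentiableOn.fun_finsetProd fun k _ ↦ ?_
  refine DifferentiableOn.div (by fun_prop) (by fun_prop) fun z hz ↦
    one_sub_conj_mul_ne_zero (ha k) (by simpa using hz)

lemma inv_prod_sub_eq_sum {a : ℕ → ℂ} (ha : Function.Injective a) {m : ℕ} (hm : m ≠ 0) {z : ℂ}
    (hz : ∀ k, a k - z ≠ 0) :
    (∏ k ∈ Finset.range m, (a k - z))⁻¹ = ∑ j ∈ Finset.range m,
      (a j - z)⁻¹ * (∏ k ∈ (Finset.range m).erase j, (a k - a j))⁻¹ := by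
  have hs : (Finset.range m).Nonempty := Finset.nonempty_range_iff.2 hm
  have h := congrArg (Polynomial.eval z)
    (Lagrange.sum_basis (ha.injOn (s := (Finset.range m : Set ℕ))) hs)
  rw [Polynomial.eval_finsetSum, Polynomial.eval_one] at h
  have hprod : ∏ k ∈ Finset.range m, (a k - z) ≠ 0 := Finset.prod_ne_zero_iff.2 fun k _ ↦ hz k
  rw [inv_eq_iff_eq_inv, eq_comm, inv_eq_iff_eq_inv, eq_comm, ← one_div, div_eq_iff hprod,
    ← h, Finset.sum_mul]
  refine Finset.sum_congr rfl fun j hj ↦ ?_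
  rw [← Finset.mul_prod_erase _ _ hj, Lagrange.basis, Polynomial.eval_prod]
  have : ∀ k ∈ (Finset.range m).erase j, Polynomial.eval z (Lagrange.basisDivisor (a j) (a k)) =
      (a k - a j)⁻¹ * (a k - z) := by
    intro k hk
    have hne : a j - a k ≠ 0 := sub_ne_zero.2 fun h ↦ (Finset.mem_erase.1 hk).1 (ha h).symm
    have hne' : a k - a j ≠ 0 := sub_ne_zero.2 fun h ↦ (Finset.mem_erase.1 hk).1 (ha h)
    simp only [Lagrange.basisDivisor, Polynomial.eval_mul, Polynomial.eval_C, Polynomial.eval_sub,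
      Polynomial.eval_X]
    field_simp
    ring
  rw [Finset.prod_congr rfl this, Finset.prod_mul_distrib, Finset.prod_inv_distrib]
  have := hz j
  field_simp

/-- The residue theorem for `u / B`, with `B` a finite Blaschke product. -/
lemma dualSum_eq_circleAverage {a : ℕ → ℂ} (ha : Function.Injective a) (had : ∀ k, ‖a k‖ < 1)
    (m : ℕ) {u : ℂ → ℂ} (hu : DiffContOnCl ℂ u (ball 0 1)) :
    dualSum a m u = circleAverage (fun z ↦ -(z * u z) / blaschke a m z) 0 1 := by
  rcases eq_or_ne m 0 with rfl | hm
  · have h : DiffContOnCl ℂ (fun z ↦ -(z * u z)) (ball 0 |1|) := by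
      rw [abs_one]
      simpa using (Differentiable.diffContOnCl (f := fun z ↦ -z) (by fun_prop)).smul hu
    have := h.circleAverage
    simpa [dualSum, blaschke] using this.symm
  set W : ℂ → ℂ := fun z ↦ ∏ k ∈ Finset.range m, (1 - (starRingEnd ℂ) (a k) * z)
  set D : ℕ → ℂ := fun j ↦ ∏ k ∈ (Finset.range m).erase j, (a k - a j)
  have hv : DiffContOnCl ℂ (fun z ↦ W z • u z) (ball 0 |1|) := by
    rw [abs_one]
    exact (Differentiable.diffContOnCl (f := W) (by unfold W; fun_prop)).smul hu
  have hpt : ∀ z ∈ sphere (0 : ℂ) |1|, -(z * u z) / blaschke a m z =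
      ∑ j ∈ Finset.range m, (D j)⁻¹ • (((z - 0) / (z - a j)) • (W z • u z)) := by
    intro z hz
    have hz : ‖z‖ = 1 := by simpa using hz
    have hk := fun k ↦ sub_ne_zero_of_norm_lt (had k) hz
    rw [blaschke, Finset.prod_div_distrib, div_div_eq_mul_div, div_eq_mul_inv,
      inv_prod_sub_eq_sum ha hm hk, Finset.mul_sum]
    refine Finset.sum_congr rfl fun j _ ↦ ?_
    have h1 := hk j
    have h2 : z - a j ≠ 0 := sub_ne_zero.2 (sub_ne_zero.1 h1).symm
    have h3 : (a j - z)⁻¹ = -(z - a j)⁻¹ := by rw [← inv_neg, neg_sub]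
    simp only [smul_eq_mul, sub_zero, h3, D, W]
    ring
  rw [circleAverage_congr_sphere hpt, circleAverage_fun_sum]
  · refine Finset.sum_congr rfl fun j _ ↦ ?_
    rw [circleAverage_fun_smul, hv.circleAverage_smul_div (by simpa using had j)]
    simp only [smul_eq_mul, D, W]
    ring
  · intro j _
    refine ContinuousOn.circleIntegrable zero_le_one ?_
    have : ContinuousOn (fun z ↦ W z • u z) (sphere 0 1) := by
      rw [abs_one] at hv
      exact hv.continuousOn_ball.mono sphere_subset_closedBall
    have hd : ContinuousOn (fun z ↦ (z - 0) / (z - a j)) (sphere 0 1) :=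
      ContinuousOn.div (by fun_prop) (by fun_prop) fun z hz ↦ by
        rw [← neg_ne_zero, neg_sub]
        exact sub_ne_zero_of_norm_lt (had j) (by simpa using hz)
    exact (hd.smul this).const_smul (D j)⁻¹

lemma mem_hardyMeans {q x : ℝ} {g : ℂ → ℂ} : x ∈ hardyMeans q g ↔
    ∃ r : ℝ, 0 < r ∧ r < 1 ∧ x = circleAverage (fun z ↦ ‖g z‖ ^ q) 0 r := by
  simp [hardyMeans, circleAverage, circleMap]

lemma hardyMeans_nonempty (q : ℝ) (g : ℂ → ℂ) : (hardyMeans q g).Nonempty :=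
  ⟨_, mem_hardyMeans.2 ⟨1 / 2, by norm_num, by norm_num, rfl⟩⟩

lemma circleAverage_norm_rpow_nonneg (q : ℝ) (g : ℂ → ℂ) (r : ℝ) :
    0 ≤ circleAverage (fun z ↦ ‖g z‖ ^ q) 0 r :=
  circleAverage_nonneg_of_nonneg fun _ _ ↦ by positivity

lemma sSup_hardyMeans_nonneg (q : ℝ) (g : ℂ → ℂ) : 0 ≤ sSup (hardyMeans q g) :=
  Real.sSup_nonneg fun _ hx ↦ by
    obtain ⟨r, _, _, rfl⟩ := mem_hardyMeans.1 hx
    exact circleAverage_norm_rpow_nonneg q g r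

lemma hardyNorm_nonneg (q : ℝ) (g : ℂ → ℂ) : 0 ≤ hardyNorm q g :=
  Real.rpow_nonneg (sSup_hardyMeans_nonneg q g) _

lemma hardyNorm_rpow {q : ℝ} (hq : 0 < q) (g : ℂ → ℂ) :
    hardyNorm q g ^ q = sSup (hardyMeans q g) := by
  rw [hardyNorm, ← Real.rpow_mul (sSup_hardyMeans_nonneg q g), one_div, inv_mul_cancel₀ hq.ne',
    Real.rpow_one]

lemma MemHardy.circleAverage_le {q : ℝ} (hq : 0 < q) {g : ℂ → ℂ} (hg : MemHardy q g) {r : ℝ}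
    (hr0 : 0 < r) (hr : r < 1) :
    circleAverage (fun z ↦ ‖g z‖ ^ q) 0 r ≤ hardyNorm q g ^ q := by
  rw [hardyNorm_rpow hq]
  exact le_csSup hg.2 (mem_hardyMeans.2 ⟨r, hr0, hr, rfl⟩)

lemma memHardy_of_diffContOnCl {q : ℝ} (hq : 1 < q) {u : ℂ → ℂ} (hu : DiffContOnCl ℂ u (ball 0 1)) :
    MemHardy q u :=
  ⟨hu.1, circleAverage (fun z ↦ ‖u z‖ ^ q) 0 1, fun _ hx ↦ by
    obtain ⟨r, hr0, hr, rfl⟩ := mem_hardyMeans.1 hx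
    exact circleAverage_norm_rpow_le hq hu hr0 hr⟩

lemma hardyNorm_rpow_le_circleAverage {q : ℝ} (hq : 1 < q) {u : ℂ → ℂ}
    (hu : DiffContOnCl ℂ u (ball 0 1)) :
    hardyNorm q u ^ q ≤ circleAverage (fun z ↦ ‖u z‖ ^ q) 0 1 := by
  rw [hardyNorm_rpow (by linarith)]
  refine csSup_le (hardyMeans_nonempty q u) fun _ hx ↦ ?_
  obtain ⟨r, hr0, hr, rfl⟩ := mem_hardyMeans.1 hx
  exact circleAverage_norm_rpow_le hq hu hr0 hr

lemma circleAverage_norm_rpow_const_mul (q : ℝ) (c : ℂ) (g : ℂ → ℂ) (r : ℝ) :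
    circleAverage (fun z ↦ ‖c * g z‖ ^ q) 0 r =
      ‖c‖ ^ q * circleAverage (fun z ↦ ‖g z‖ ^ q) 0 r := by
  simp only [norm_mul, Real.mul_rpow (norm_nonneg _) (norm_nonneg _)]
  rw [← smul_eq_mul (‖c‖ ^ q), ← circleAverage_fun_smul]
  simp only [smul_eq_mul]

open Pointwise in
lemma hardyMeans_const_mul (q : ℝ) (c : ℂ) (g : ℂ → ℂ) :
    hardyMeans q (fun z ↦ c * g z) = ‖c‖ ^ q • hardyMeans q g := by
  ext x
  simp only [Set.mem_smul_set, mem_hardyMeans, circleAverage_norm_rpow_const_mul, smul_eq_mul]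
  constructor
  · rintro ⟨r, h0, h1, rfl⟩
    exact ⟨_, ⟨r, h0, h1, rfl⟩, rfl⟩
  · rintro ⟨_, ⟨r, h0, h1, rfl⟩, rfl⟩
    exact ⟨r, h0, h1, rfl⟩

lemma MemHardy.const_mul {q : ℝ} {g : ℂ → ℂ} (hg : MemHardy q g) (c : ℂ) :
    MemHardy q (fun z ↦ c * g z) := by
  refine ⟨hg.1.const_mul c, ?_⟩
  rw [hardyMeans_const_mul]
  exact hg.2.smul_of_nonneg (by positivity)

lemma hardyNorm_const_mul {q : ℝ} (hq : 0 < q) (c : ℂ) (g : ℂ → ℂ) :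
    hardyNorm q (fun z ↦ c * g z) = ‖c‖ * hardyNorm q g := by
  rw [hardyNorm, hardyNorm, hardyMeans_const_mul, Real.sSup_smul_of_nonneg (by positivity),
    smul_eq_mul, Real.mul_rpow (by positivity) (sSup_hardyMeans_nonneg q g),
    ← Real.rpow_mul (norm_nonneg c), one_div, mul_inv_cancel₀ hq.ne', Real.rpow_one]

lemma dualSum_const_mul (a : ℕ → ℂ) (m : ℕ) (c : ℂ) (g : ℂ → ℂ) :
    dualSum a m (fun z ↦ c * g z) = c * dualSum a m g := by
  simp only [dualSum, Finset.mul_sum, mul_assoc]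

lemma diffContOnCl_dilation {g : ℂ → ℂ} (hg : DifferentiableOn ℂ g (ball 0 1)) {r : ℝ}
    (hr0 : 0 < r) (hr : r < 1) : DiffContOnCl ℂ (fun z ↦ g (r * z)) (ball 0 1) := by
  refine diffContOnCl_of_differentiableOn (hg.comp (by fun_prop) fun z hz ↦ ?_)
  have hz : ‖z‖ ≤ 1 := by simpa using hz
  simp only [mem_ball, dist_zero_right, norm_mul, norm_real, Real.norm_of_nonneg hr0.le]
  nlinarith

lemma circleAverage_norm_rpow_dilation (q : ℝ) (g : ℂ → ℂ) (r : ℝ) :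
    circleAverage (fun z ↦ ‖g (r * z)‖ ^ q) 0 1 = circleAverage (fun z ↦ ‖g z‖ ^ q) 0 r := by
  simp [circleAverage, circleMap]

/-- Point evaluations are bounded on `H^q`. -/
lemma exists_norm_apply_le {q : ℝ} (hq : 1 < q) {w : ℂ} (hw : ‖w‖ < 1) :
    ∃ C : ℝ, 0 ≤ C ∧ ∀ g, MemHardy q g → ‖g w‖ ≤ C * hardyNorm q g := by
  have hq0 : 0 < q := by linarith
  obtain ⟨r, hwr, hr⟩ := exists_between hw
  have hr0 : 0 < r := (norm_nonneg w).trans_lt hwr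
  set v : ℂ := w / r
  have hv : ‖v‖ < 1 := by
    rw [norm_div, norm_real, Real.norm_of_nonneg hr0.le, div_lt_one hr0]; exact hwr
  have hrv : (r : ℂ) * v = w := mul_div_cancel₀ w (by exact_mod_cast hr0.ne')
  set K := (1 + ‖v‖) / (1 - ‖v‖)
  have hK : 0 ≤ K := div_nonneg (by positivity) (by linarith)
  refine ⟨K ^ (1 / q), by positivity, fun g hg ↦ ?_⟩
  have hd := diffContOnCl_dilation hg.1 hr0 hr
  have h1 := norm_rpow_le_circleAverage_poissonKernel hq hd hv
  have hc := hd.continuousOn_sphere.norm_rpow hq0.le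
  have h2 : circleAverage (fun z ↦ poissonKernel 0 v z * ‖g (r * z)‖ ^ q) 0 1 ≤
      K * hardyNorm q g ^ q := by
    refine le_trans ?_ (mul_le_mul_of_nonneg_left (hg.circleAverage_le hq0 hr0 hr) hK)
    rw [← circleAverage_norm_rpow_dilation, ← smul_eq_mul, ← circleAverage_fun_smul]
    refine circleAverage_mono (circleIntegrable_of_continuousOn_sphere
      ((continuousOn_poissonKernel hv).mul hc))
      (circleIntegrable_of_continuousOn_sphere (hc.const_smul K)) fun z hz ↦ ?_
    exact mul_le_mul_of_nonneg_right (poissonKernel_le hv (by simpa using hz)) (by positivity)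
  rw [hrv] at h1
  have h3 := Real.rpow_le_rpow (by positivity) (h1.trans h2) (by positivity : 0 ≤ 1 / q)
  have hN := hardyNorm_nonneg q g
  rwa [Real.mul_rpow hK (by positivity), ← Real.rpow_mul (norm_nonneg _), ← Real.rpow_mul hN,
    mul_one_div_cancel hq0.ne', Real.rpow_one, Real.rpow_one] at h3

lemma exists_norm_dualSum_le {q : ℝ} (hq : 1 < q) {a : ℕ → ℂ} (ha : ∀ k, ‖a k‖ < 1) (m : ℕ) :
    ∃ C : ℝ, ∀ g, MemHardy q g → ‖dualSum a m g‖ ≤ C * hardyNorm q g := by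
  choose C _ hC using fun k ↦ exists_norm_apply_le hq (ha k)
  refine ⟨∑ j ∈ Finset.range m, C j * ‖(∏ k ∈ Finset.range m, (1 - (starRingEnd ℂ) (a k) * a j)) /
      (∏ k ∈ (Finset.range m).erase j, (a k - a j))‖, fun g hg ↦ ?_⟩
  rw [Finset.sum_mul]
  refine (norm_sum_le _ _).trans (Finset.sum_le_sum fun j _ ↦ ?_)
  rw [norm_mul, mul_right_comm]
  exact mul_le_mul_of_nonneg_right (hC j g hg) (norm_nonneg _)

lemma bddAbove_dualValues {q : ℝ} (hq : 1 < q) {a : ℕ → ℂ} (ha : ∀ k, ‖a k‖ < 1) (m : ℕ) :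
    BddAbove (dualValues q a m) := by
  obtain ⟨C, hC⟩ := exists_norm_dualSum_le hq ha m
  refine ⟨C, ?_⟩
  rintro _ ⟨g, hg, h1, rfl⟩
  simpa [h1] using hC g hg

lemma sSup_dualValues_nonneg (q : ℝ) (a : ℕ → ℂ) (m : ℕ) : 0 ≤ sSup (dualValues q a m) :=
  Real.sSup_nonneg fun _ ⟨_, _, _, h⟩ ↦ h ▸ norm_nonneg _

lemma dualValues_nonempty {q : ℝ} (hq : 1 < q) (a : ℕ → ℂ) (m : ℕ) :
    (dualValues q a m).Nonempty := by
  refine ⟨_, fun _ ↦ 1, memHardy_of_diffContOnCl hq diffContOnCl_const, ?_, rfl⟩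
  have : hardyMeans q (fun _ ↦ 1) = {1} := by
    ext x
    simp only [mem_hardyMeans, norm_one, Real.one_rpow, circleAverage_const, Set.mem_singleton_iff]
    exact ⟨fun ⟨_, _, _, h⟩ ↦ h, fun h ↦ ⟨1 / 2, by norm_num, by norm_num, h⟩⟩
  simp [hardyNorm, this]

lemma norm_dualSum_le {q : ℝ} (hq : 1 < q) {a : ℕ → ℂ} (ha : ∀ k, ‖a k‖ < 1) (m : ℕ)
    {g : ℂ → ℂ} (hg : MemHardy q g) :
    ‖dualSum a m g‖ ≤ sSup (dualValues q a m) * hardyNorm q g := by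
  have hq0 : 0 < q := by linarith
  rcases (hardyNorm_nonneg q g).eq_or_lt with h | h
  · obtain ⟨C, hC⟩ := exists_norm_dualSum_le hq ha m
    have := hC g hg
    rwa [← h, mul_zero] at this ⊢
  · have hn : ‖((hardyNorm q g)⁻¹ : ℂ)‖ = (hardyNorm q g)⁻¹ := by
      rw [norm_inv, norm_real, Real.norm_of_nonneg h.le]
    have := le_csSup (bddAbove_dualValues hq ha m)
      ⟨_, hg.const_mul ((hardyNorm q g)⁻¹ : ℂ), by
        rw [hardyNorm_const_mul hq0, hn, inv_mul_cancel₀ h.ne'], rfl⟩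
    rwa [dualSum_const_mul, norm_mul, hn, inv_mul_le_iff₀ h, mul_comm] at this

/-- The maximum over `u` of `Re Λ(u) - ‖u‖ ^ q / q` is at most `‖Λ‖ ^ p / p`. -/
lemma re_dualSum_sub_le {p q : ℝ} (hpq : q.HolderConjugate p) {a : ℕ → ℂ} (ha : ∀ k, ‖a k‖ < 1)
    (m : ℕ) {u : ℂ → ℂ} (hu : DiffContOnCl ℂ u (ball 0 1)) :
    (dualSum a m u).re - circleAverage (fun z ↦ ‖u z‖ ^ q) 0 1 / q ≤
      sSup (dualValues q a m) ^ p / p := by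
  have hq := hpq.lt
  have h1 := (re_le_norm _).trans (norm_dualSum_le hq ha m (memHardy_of_diffContOnCl hq hu))
  have h2 := Real.young_inequality_of_nonneg (hardyNorm_nonneg q u)
    (sSup_dualValues_nonneg q a m) hpq
  have h3 := div_le_div_of_nonneg_right (hardyNorm_rpow_le_circleAverage hq hu) hpq.nonneg
  linarith

lemma circleAverage_re {f : ℂ → ℂ} (hf : CircleIntegrable f 0 1) :
    circleAverage (fun z ↦ (f z).re) 0 1 = (circleAverage f 0 1).re :=
  Complex.reCLM.circleAverage_comp_comm hf

lemma convexOn_norm_rpow_segment_one {q : ℝ} (hq : 1 ≤ q) (w : ℂ) {t : ℝ} (h0 : 0 ≤ t)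
    (h1 : t ≤ 1) : ‖(1 - t) * w + t‖ ^ q ≤ (1 - t) * ‖w‖ ^ q + t := by
  have h := (convexOn_rpow hq).2 (norm_nonneg w) (zero_le_one (α := ℝ)) (sub_nonneg.2 h1) h0
    (sub_add_cancel 1 t)
  simp only [smul_eq_mul, Real.one_rpow, mul_one] at h
  refine le_trans (Real.rpow_le_rpow (norm_nonneg _) ?_ (by linarith)) h
  refine (norm_add_le _ _).trans (le_of_eq ?_)
  rw [norm_mul, ← ofReal_one, ← ofReal_sub, norm_real, norm_real,
    Real.norm_of_nonneg (sub_nonneg.2 h1), Real.norm_of_nonneg h0]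

lemma re_mul_sub_norm_rpow_le {p q : ℝ} (hpq : q.HolderConjugate p) (w v : ℂ) :
    (w * v).re - ‖w‖ ^ q / q ≤ ‖v‖ ^ p / p := by
  have h1 := re_le_norm (w * v)
  rw [norm_mul] at h1
  linarith [Real.young_inequality_of_nonneg (norm_nonneg w) (norm_nonneg v) hpq]

/-- The concave function `w ↦ Re w - ‖w‖ ^ q / q` attains its maximum `1 / p` at `w = 1`. -/
lemma re_sub_norm_rpow_segment_one {p q κ t : ℝ} (hpq : q.HolderConjugate p) (w : ℂ)
    (hκ : 0 ≤ κ) (hκt : κ ≤ t) (ht : t ≤ 1) :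
    (1 - κ) * (w.re - ‖w‖ ^ q / q) + κ / p ≤
      ((1 - t) * w + t : ℂ).re - ‖(1 - t) * w + t‖ ^ q / q := by
  have h1 := re_mul_sub_norm_rpow_le hpq w 1
  rw [mul_one, norm_one, Real.one_rpow] at h1
  have h2 := div_le_div_of_nonneg_right
    (convexOn_norm_rpow_segment_one hpq.lt.le w (hκ.trans hκt) ht) hpq.nonneg
  have h3 : ((1 - t) * w + t : ℂ).re = (1 - t) * w.re + t := by
    simp
  have h4 := hpq.inv_add_inv_eq_one
  have h5 : t / p = t - t / q := by
    rw [div_eq_mul_inv, div_eq_mul_inv, eq_sub_of_add_eq' h4]; ring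
  have h6 : (t - κ) * (w.re - ‖w‖ ^ q / q) ≤ (t - κ) * (1 / p) :=
    mul_le_mul_of_nonneg_left h1 (sub_nonneg.2 hκt)
  have h7 : ((1 - t) * ‖w‖ ^ q + t) / q = (1 - t) * (‖w‖ ^ q / q) + t / q := by ring
  have h8 : (t - κ) * (1 / p) = t / p - κ / p := by ring
  rw [h3]
  nlinarith

lemma ofReal_poissonKernel {a z : ℂ} (hz : ‖z‖ = 1) :
    (poissonKernel 0 a z : ℂ) =
      z * (1 - ‖a‖ ^ 2) / ((1 - (starRingEnd ℂ) a * z) * (z - a)) := by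
  have hzz : z * (starRingEnd ℂ) z = 1 := by
    rw [Complex.mul_conj, Complex.normSq_eq_norm_sq, hz]; norm_num
  have hz0 : z ≠ 0 := fun h ↦ by simp [h] at hz
  have h1 : 1 - (starRingEnd ℂ) a * z = z * (starRingEnd ℂ) (z - a) := by
    rw [map_sub, mul_sub, hzz]; ring
  rw [poissonKernel, sub_zero, sub_zero, hz, h1, ofReal_div, ofReal_pow (‖z - a‖),
    ← Complex.mul_conj', mul_assoc, mul_div_mul_left _ _ hz0, mul_comm ((starRingEnd ℂ) _)]
  push_cast
  norm_num

/-- The boundary function whose circle average is `dualSum a m u`. -/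
noncomputable def boundaryQuotient (a : ℕ → ℂ) (m : ℕ) (u : ℂ → ℂ) (z : ℂ) : ℂ :=
  -(z * u z) / blaschke a m z

lemma norm_boundaryQuotient {a : ℕ → ℂ} (ha : ∀ k, ‖a k‖ < 1) (m : ℕ) (u : ℂ → ℂ) {z : ℂ}
    (hz : ‖z‖ = 1) : ‖boundaryQuotient a m u z‖ = ‖u z‖ := by
  rw [boundaryQuotient, norm_div, norm_blaschke ha m hz, norm_neg, norm_mul, hz, one_mul, div_one]

lemma continuousOn_boundaryQuotient {a : ℕ → ℂ} (ha : ∀ k, ‖a k‖ < 1) (m : ℕ) {u : ℂ → ℂ}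
    (hu : DiffContOnCl ℂ u (ball 0 1)) : ContinuousOn (boundaryQuotient a m u) (sphere 0 1) :=
  (continuousOn_id.mul hu.continuousOn_sphere).neg.div
    ((differentiableOn_blaschke ha m).continuousOn.mono sphere_subset_closedBall)
    fun _ hz ↦ blaschke_ne_zero ha m (by simpa using hz)

lemma re_dualSum_sub_eq {q : ℝ} (hq : 0 < q) {a : ℕ → ℂ} (ha : Function.Injective a)
    (had : ∀ k, ‖a k‖ < 1) (m : ℕ) {u : ℂ → ℂ} (hu : DiffContOnCl ℂ u (ball 0 1)) :
    (dualSum a m u).re - circleAverage (fun z ↦ ‖u z‖ ^ q) 0 1 / q =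
      circleAverage (fun z ↦ (boundaryQuotient a m u z).re -
        ‖boundaryQuotient a m u z‖ ^ q / q) 0 1 := by
  have hc := continuousOn_boundaryQuotient had m hu
  have i1 : CircleIntegrable (fun z ↦ (boundaryQuotient a m u z).re) 0 1 :=
    circleIntegrable_of_continuousOn_sphere (continuous_re.comp_continuousOn hc)
  rw [circleAverage_fun_sub i1
      (circleIntegrable_of_continuousOn_sphere ((hc.norm_rpow hq.le).div_const q)),
    circleAverage_re (circleIntegrable_of_continuousOn_sphere hc),
    dualSum_eq_circleAverage ha had m hu]
  congr 1
  rw [div_eq_inv_mul, ← smul_eq_mul, ← circleAverage_fun_smul]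
  refine circleAverage_congr_sphere fun z hz ↦ ?_
  rw [norm_boundaryQuotient had m u (by simpa using hz), smul_eq_mul, div_eq_inv_mul]

/-- The competitor for `m + 1` points whose boundary quotient is a convex combination of that of
`u` and the constant `1`, with a multiple of the Poisson kernel as weight. -/
noncomputable def competitor (a : ℕ → ℂ) (m : ℕ) (ε : ℝ) (u : ℂ → ℂ) (z : ℂ) : ℂ :=
  (a m - z) / (1 - (starRingEnd ℂ) (a m) * z) * u z +
    ε * (1 - ‖a m‖ ^ 2) / (1 - (starRingEnd ℂ) (a m) * z) ^ 2 * (z * u z + blaschke a m z)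

lemma diffContOnCl_competitor {a : ℕ → ℂ} (ha : ∀ k, ‖a k‖ < 1) (m : ℕ) (ε : ℝ) {u : ℂ → ℂ}
    (hu : DiffContOnCl ℂ u (ball 0 1)) : DiffContOnCl ℂ (competitor a m ε u) (ball 0 1) := by
  have hne : ∀ z ∈ closedBall (0 : ℂ) 1, 1 - (starRingEnd ℂ) (a m) * z ≠ 0 := fun z hz ↦
    one_sub_conj_mul_ne_zero (ha m) (by simpa using hz)
  have h1 : DiffContOnCl ℂ (fun z ↦ (a m - z) / (1 - (starRingEnd ℂ) (a m) * z)) (ball 0 1) :=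
    diffContOnCl_of_differentiableOn (DifferentiableOn.div (by fun_prop) (by fun_prop) hne)
  have h2 : DiffContOnCl ℂ (fun z ↦ (ε * (1 - ‖a m‖ ^ 2) : ℂ) /
      (1 - (starRingEnd ℂ) (a m) * z) ^ 2) (ball 0 1) :=
    diffContOnCl_of_differentiableOn (DifferentiableOn.div (by fun_prop) (by fun_prop)
      fun z hz ↦ pow_ne_zero 2 (hne z hz))
  have h3 : DiffContOnCl ℂ (blaschke a m) (ball 0 1) :=
    diffContOnCl_of_differentiableOn (differentiableOn_blaschke ha m)
  have h4 : DiffContOnCl ℂ (fun z : ℂ ↦ z) (ball 0 1) := differentiable_id.diffContOnCl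
  exact (h1.smul hu).add (h2.smul ((h4.smul hu).add h3))

lemma boundaryQuotient_competitor {a : ℕ → ℂ} (ha : ∀ k, ‖a k‖ < 1) (m : ℕ) (ε : ℝ) (u : ℂ → ℂ)
    {z : ℂ} (hz : ‖z‖ = 1) :
    boundaryQuotient a (m + 1) (competitor a m ε u) z =
      (1 - (ε * poissonKernel 0 (a m) z : ℝ)) * boundaryQuotient a m u z +
        (ε * poissonKernel 0 (a m) z : ℝ) := by
  have hB := blaschke_ne_zero ha m hz
  have h1 := one_sub_conj_mul_ne_zero (ha m) hz.le
  have h2 := sub_ne_zero_of_norm_lt (ha m) hz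
  have h3 : z - a m ≠ 0 := sub_ne_zero.2 (sub_ne_zero.1 h2).symm
  rw [ofReal_mul, ofReal_poissonKernel hz, boundaryQuotient, boundaryQuotient, competitor,
    blaschke_succ, ← neg_sub z (a m)]
  generalize 1 - (starRingEnd ℂ) (a m) * z = d at *
  generalize z - a m = e at *
  field_simp
  ring

/-- Passing from `m` to `m + 1` points raises `Re Λ(u) - ‖u‖ ^ q / q` by a fixed fraction of its
distance from `1 / p`. -/
lemma exists_gain {p q : ℝ} (hpq : q.HolderConjugate p) {a : ℕ → ℂ} (ha : Function.Injective a)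
    (had : ∀ k, ‖a k‖ < 1) (m : ℕ) :
    ∃ κ : ℝ, 0 < κ ∧ ∀ u, DiffContOnCl ℂ u (ball 0 1) → ∃ u', DiffContOnCl ℂ u' (ball 0 1) ∧
      (1 - κ) * ((dualSum a m u).re - circleAverage (fun z ↦ ‖u z‖ ^ q) 0 1 / q) + κ / p ≤
        (dualSum a (m + 1) u').re - circleAverage (fun z ↦ ‖u' z‖ ^ q) 0 1 / q := by
  have hq := hpq.pos
  set ε := (1 - ‖a m‖) / (1 + ‖a m‖)
  have hm := had m
  have hm0 : 0 < 1 - ‖a m‖ := by linarith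
  have hm1 : 0 < 1 + ‖a m‖ := by positivity
  have hε : 0 < ε := div_pos hm0 hm1
  refine ⟨ε * ε, mul_pos hε hε, fun u hu ↦ ⟨_, diffContOnCl_competitor had m ε hu, ?_⟩⟩
  have hint : ∀ (n : ℕ) {v : ℂ → ℂ}, DiffContOnCl ℂ v (ball 0 1) →
      CircleIntegrable (fun z ↦ (boundaryQuotient a n v z).re -
        ‖boundaryQuotient a n v z‖ ^ q / q) 0 1 := fun n v hv ↦ by
    have hc := continuousOn_boundaryQuotient had n hv
    exact circleIntegrable_of_continuousOn_sphere ((continuous_re.comp_continuousOn hc).sub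
      ((hc.norm_rpow hq.le).div_const q))
  rw [re_dualSum_sub_eq hq ha had m hu, re_dualSum_sub_eq hq ha had (m + 1)
    (diffContOnCl_competitor had m ε hu), ← smul_eq_mul (1 - ε * ε), ← circleAverage_fun_smul,
    ← circleAverage_const (ε * ε / p) 0 1, ← circleAverage_fun_add]
  · refine circleAverage_mono ?_ (hint _ (diffContOnCl_competitor had m ε hu)) fun z hz ↦ ?_
    · exact ((hint m hu).const_smul).add (circleIntegrable_const _ _ _)
    have hz : ‖z‖ = 1 := by simpa using hz
    rw [boundaryQuotient_competitor had m ε u hz, smul_eq_mul]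
    refine re_sub_norm_rpow_segment_one hpq _ (by positivity) ?_ ?_
    · exact mul_le_mul_of_nonneg_left (le_poissonKernel hm hz) hε.le
    · refine (mul_le_mul_of_nonneg_left (poissonKernel_le hm hz) hε.le).trans (le_of_eq ?_)
      simp only [ε]
      field_simp
  · exact (hint m hu).const_smul
  · exact circleIntegrable_const _ _ _

lemma one_sub_rpow_le {s x : ℝ} (hs : 0 ≤ s) (hx : x ≤ 1) (hsx : |s * x| ≤ 1) :
    (1 - x) ^ s ≤ 1 - s * x + (s * x) ^ 2 := by
  have h1 : (1 - x) ^ s ≤ Real.exp (-(s * x)) := by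
    have := Real.rpow_le_rpow (sub_nonneg.2 hx) (Real.one_sub_le_exp_neg x) hs
    rwa [← Real.exp_mul, neg_mul, mul_comm x] at this
  have h2 := (abs_le.1 (Real.abs_exp_sub_one_sub_id_le (x := -(s * x)) (by rwa [abs_neg]))).2
  rw [neg_sq] at h2
  linarith

/-- The function `1 - ε * conj (B 0) * B` has `L^p` norm less than `1` on the circle for small
`ε > 0`. -/
lemma exists_circleAverage_norm_rpow_lt_one {p : ℝ} (hp : 0 < p) {a : ℕ → ℂ}
    (had : ∀ k, ‖a k‖ < 1) (ha0 : ∀ k, a k ≠ 0) (m : ℕ) : ∃ ε : ℝ, circleAverage (fun z ↦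
      ‖1 - ε * ((starRingEnd ℂ) (blaschke a m 0) * blaschke a m z)‖ ^ p) 0 1 < 1 := by
  set w : ℂ → ℂ := fun z ↦ (starRingEnd ℂ) (blaschke a m 0) * blaschke a m z with hw
  set b := ‖blaschke a m 0‖ with hb
  have hb0 : 0 < b := norm_pos_iff.2 (blaschke_zero_ne_zero ha0 m)
  have hb1 : b ≤ 1 := by
    rw [hb, blaschke, norm_prod]
    exact Finset.prod_le_one (fun _ _ ↦ norm_nonneg _) fun k _ ↦ by simpa using (had k).le
  have hwd : DiffContOnCl ℂ w (ball 0 1) :=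
    diffContOnCl_of_differentiableOn ((differentiableOn_blaschke had m).const_mul _)
  have hwc := hwd.continuousOn_sphere
  have hwav : circleAverage (fun z ↦ (w z).re) 0 1 = b ^ 2 := by
    rw [circleAverage_re (circleIntegrable_of_continuousOn_sphere hwc),
      DiffContOnCl.circleAverage (by rwa [abs_one]), hw]
    simp only [mul_comm ((starRingEnd ℂ) _), Complex.mul_conj']
    exact_mod_cast rfl
  set s := p / 2 with hs
  have hs0 : 0 < s := by positivity
  set ε := 1 / (1 + 9 * s) with hε
  have hε0 : 0 < ε := by positivity
  have hε1 : ε * (1 + 9 * s) = 1 := one_div_mul_cancel (by positivity)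
  set y := ε * b with hy
  have hy0 : 0 < y := by positivity
  have hyε : y ≤ ε := by nlinarith
  have hy1 : y ≤ 1 := by nlinarith
  have hsy : s * (3 * y) ≤ 1 := by nlinarith
  refine ⟨ε, ?_⟩
  have hpt : ∀ z ∈ sphere (0 : ℂ) |1|, ‖1 - ε * w z‖ ^ p ≤
      (1 + s * y ^ 2 + 9 * s ^ 2 * y ^ 2) + (-(2 * s * ε)) • (w z).re := by
    intro z hz
    have hz : ‖z‖ = 1 := by simpa using hz
    have hwz : ‖w z‖ = b := by
      simp only [w, norm_mul, RCLike.norm_conj, norm_blaschke had m hz, mul_one, hb]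
    have hre : |(w z).re| ≤ b := hwz ▸ abs_re_le_norm (w z)
    set x := 2 * ε * (w z).re - y ^ 2 with hx
    have hsq : ‖1 - ε * w z‖ ^ 2 = 1 - x := by
      rw [← Complex.normSq_eq_norm_sq, Complex.normSq_sub, Complex.normSq_mul,
        Complex.normSq_eq_norm_sq (w z), hwz]
      simp [hx, hy]
      ring
    have hxa : |x| ≤ 3 * y := by
      obtain ⟨h1, h2⟩ := abs_le.1 hre
      rw [abs_le]
      constructor <;> nlinarith [mul_le_mul_of_nonneg_left h2 hε0.le,
        mul_le_mul_of_nonneg_left h1 hε0.le]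
    have hx1 : x ≤ 1 := by
      have := sq_nonneg ‖1 - ε * w z‖
      linarith
    have hsx : |s * x| ≤ s * (3 * y) := by
      rw [abs_mul, abs_of_pos hs0]
      exact mul_le_mul_of_nonneg_left hxa hs0.le
    have h := one_sub_rpow_le hs0.le hx1 (hsx.trans hsy)
    rw [← hsq, ← Real.rpow_natCast, ← Real.rpow_mul (norm_nonneg _)] at h
    have hps : ((2 : ℕ) : ℝ) * s = p := by rw [hs]; push_cast; ring
    rw [hps] at h
    have hq2 : (s * x) ^ 2 ≤ (s * (3 * y)) ^ 2 := by
      rw [← sq_abs]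
      exact pow_le_pow_left₀ (abs_nonneg _) hsx 2
    rw [smul_eq_mul]
    calc _ ≤ _ := h
      _ ≤ 1 - s * x + (s * (3 * y)) ^ 2 := by linarith
      _ = _ := by rw [hx]; ring
  have i1 : CircleIntegrable (fun z ↦ (w z).re) 0 1 :=
    circleIntegrable_of_continuousOn_sphere (continuous_re.comp_continuousOn hwc)
  have hle := circleAverage_mono (circleIntegrable_of_continuousOn_sphere
    ((continuousOn_const.sub (continuousOn_const.mul hwc)).norm_rpow hp.le))
    ((circleIntegrable_const _ _ _).add (i1.const_smul)) hpt
  refine hle.trans_lt ?_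
  rw [circleAverage_add (circleIntegrable_const _ _ _) (i1.const_smul), circleAverage_const,
    circleAverage_smul, hwav, smul_eq_mul]
  have : s * y * ε * (1 + 9 * s) * b - 2 * s * y * b < 0 := by
    have : s * y * ε * (1 + 9 * s) * b = s * y * b := by
      calc _ = s * y * b * (ε * (1 + 9 * s)) := by ring
        _ = _ := by rw [hε1, mul_one]
    have : 0 < s * y * b := by positivity
    linarith
  have e : 1 + s * y ^ 2 + 9 * s ^ 2 * y ^ 2 + -(2 * s * ε) * b ^ 2 =
      1 + (s * y * ε * (1 + 9 * s) * b - 2 * s * y * b) := by rw [hy]; ring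
  linarith

/-- The functional `u ↦ Re Λ(u) - ‖u‖ ^ q / q` stays away from `1 / p`. -/
lemma exists_re_dualSum_sub_le {p q : ℝ} (hpq : q.HolderConjugate p) {a : ℕ → ℂ}
    (ha : Function.Injective a) (had : ∀ k, ‖a k‖ < 1) (ha0 : ∀ k, a k ≠ 0) (m : ℕ) :
    ∃ σ < 1 / p, ∀ u, DiffContOnCl ℂ u (ball 0 1) →
      (dualSum a m u).re - circleAverage (fun z ↦ ‖u z‖ ^ q) 0 1 / q ≤ σ := by
  have hq := hpq.pos
  have hp := hpq.symm.pos
  obtain ⟨ε, hε⟩ := exists_circleAverage_norm_rpow_lt_one hp had ha0 m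
  set w : ℂ → ℂ := fun z ↦ (starRingEnd ℂ) (blaschke a m 0) * blaschke a m z with hw
  set v : ℂ → ℂ := fun z ↦ 1 - ε * w z
  have hwd : DiffContOnCl ℂ w (ball 0 1) :=
    diffContOnCl_of_differentiableOn ((differentiableOn_blaschke had m).const_mul _)
  have hvc : ContinuousOn v (sphere 0 1) :=
    continuousOn_const.sub (continuousOn_const.mul hwd.continuousOn_sphere)
  refine ⟨circleAverage (fun z ↦ ‖v z‖ ^ p) 0 1 / p, div_lt_div_of_pos_right hε hp,
    fun u hu ↦ ?_⟩
  have hc := continuousOn_boundaryQuotient had m hu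
  have hzero : circleAverage
      (fun z ↦ (ε * (starRingEnd ℂ) (blaschke a m 0)) • (z • u z)) 0 1 = 0 := by
    have h4 : DiffContOnCl ℂ (fun z : ℂ ↦ z) (ball 0 1) := differentiable_id.diffContOnCl
    rw [circleAverage_fun_smul, DiffContOnCl.circleAverage (by rw [abs_one]; exact h4.smul hu)]
    simp
  have i0 : CircleIntegrable
      (fun z ↦ (ε * (starRingEnd ℂ) (blaschke a m 0)) • (z • u z)) 0 1 :=
    circleIntegrable_of_continuousOn_sphere
      ((continuousOn_id.smul hu.continuousOn_sphere).const_smul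
        (ε * (starRingEnd ℂ) (blaschke a m 0)))
  have hGv : dualSum a m u = circleAverage (fun z ↦ boundaryQuotient a m u z * v z) 0 1 := by
    have h := circleAverage_fun_add (circleIntegrable_of_continuousOn_sphere hc) i0
    rw [hzero, add_zero] at h
    refine (dualSum_eq_circleAverage ha had m hu).trans (h.symm.trans ?_)
    refine circleAverage_congr_sphere fun z hz ↦ ?_
    have := blaschke_ne_zero had m (z := z) (by simpa using hz)
    simp only [boundaryQuotient, v, w, smul_eq_mul]
    field_simp
    ring
  have i1 : CircleIntegrable (fun z ↦ (boundaryQuotient a m u z * v z).re) 0 1 :=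
    circleIntegrable_of_continuousOn_sphere (continuous_re.comp_continuousOn (hc.mul hvc))
  have i2 := circleIntegrable_of_continuousOn_sphere (hu.continuousOn_sphere.norm_rpow hq.le)
  have i3 := circleIntegrable_of_continuousOn_sphere (hvc.norm_rpow hp.le)
  have i4 : CircleIntegrable (fun z ↦ boundaryQuotient a m u z * v z) 0 1 :=
    circleIntegrable_of_continuousOn_sphere (hc.mul hvc)
  rw [hGv, ← circleAverage_re i4,
    div_eq_inv_mul, div_eq_inv_mul, ← smul_eq_mul, ← smul_eq_mul, ← circleAverage_smul,
    ← circleAverage_smul, ← circleAverage_sub i1 i2.const_smul]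
  refine circleAverage_mono (i1.sub i2.const_smul) i3.const_smul fun z hz ↦ ?_
  have h := re_mul_sub_norm_rpow_le hpq (boundaryQuotient a m u z) (v z)
  rwa [norm_boundaryQuotient had m u (by simpa using hz), div_eq_inv_mul, div_eq_inv_mul] at h

lemma tendsto_dualSum_dilation {a : ℕ → ℂ} (had : ∀ k, ‖a k‖ < 1) (m : ℕ) {g : ℂ → ℂ}
    (hg : DifferentiableOn ℂ g (ball 0 1)) :
    Filter.Tendsto (fun r : ℝ ↦ dualSum a m (fun z ↦ g (r * z))) (nhdsWithin 1 (Set.Iio 1))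
      (nhds (dualSum a m g)) := by
  unfold dualSum
  refine tendsto_finsetSum _ fun j _ ↦ Filter.Tendsto.mul_const _ ?_
  have h1 : ContinuousAt g (a j) :=
    hg.continuousOn.continuousAt (isOpen_ball.mem_nhds (by simpa using had j))
  have h2 : Filter.Tendsto (fun r : ℝ ↦ (r : ℂ) * a j) (nhds 1) (nhds (a j)) := by
    have : Continuous fun r : ℝ ↦ (r : ℂ) * a j := by fun_prop
    simpa using this.tendsto 1
  exact (h1.tendsto.comp h2).mono_left nhdsWithin_le_nhds

lemma exists_rpow_add_le {p q : ℝ} (hpq : q.HolderConjugate p) {a : ℕ → ℂ}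
    (ha : Function.Injective a) (had : ∀ k, ‖a k‖ < 1) (ha0 : ∀ k, a k ≠ 0) (m : ℕ) :
    ∃ δ > 0, ∀ x ∈ dualValues q a m, x ^ p + δ ≤ sSup (dualValues q a (m + 1)) ^ p := by
  have hq := hpq.pos
  have hp := hpq.symm.pos
  obtain ⟨κ, hκ, hgain⟩ := exists_gain hpq ha had m
  obtain ⟨σ, hσ, hle⟩ := exists_re_dualSum_sub_le hpq ha had ha0 m
  refine ⟨p * (κ * (1 / p - σ)), mul_pos hp (mul_pos hκ (sub_pos.2 hσ)), ?_⟩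
  rintro _ ⟨g, hg, hg1, rfl⟩
  set M := sSup (dualValues q a (m + 1))
  have hall : ∀ u, DiffContOnCl ℂ u (ball 0 1) → (dualSum a m u).re -
      circleAverage (fun z ↦ ‖u z‖ ^ q) 0 1 / q + κ * (1 / p - σ) ≤ M ^ p / p := by
    intro u hu
    obtain ⟨u', hu', h⟩ := hgain u hu
    have h1 := h.trans (re_dualSum_sub_le hpq had (m + 1) hu')
    have h2 := mul_le_mul_of_nonneg_left (hle u hu) hκ.le
    have h3 : κ / p = κ * (1 / p) := by ring
    linarith
  set x := ‖dualSum a m g‖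
  have hx : 0 ≤ x := norm_nonneg _
  obtain ⟨c, hc, hcx⟩ : ∃ c : ℂ, ‖c‖ = 1 ∧ c * dualSum a m g = x := by
    rcases eq_or_ne (dualSum a m g) 0 with h | h
    · exact ⟨1, norm_one, by simp [x, h]⟩
    · have hx0 : (x : ℂ) ≠ 0 := by exact_mod_cast norm_ne_zero_iff.2 h
      refine ⟨x / dualSum a m g, ?_, div_mul_cancel₀ _ h⟩
      rw [norm_div, norm_real, norm_norm, div_self (norm_ne_zero_iff.2 h)]
  set l := x ^ (p - 1)
  have hl : 0 ≤ l := Real.rpow_nonneg hx _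
  have hlx : l * x = x ^ p := by
    rcases hx.eq_or_lt with h | h
    · rw [← h, mul_zero, Real.zero_rpow hp.ne']
    · rw [← Real.rpow_add_one h.ne', sub_add_cancel]
  have hlq : l ^ q = x ^ p := by
    rw [← Real.rpow_mul hx, hpq.symm.sub_one_mul_conj]
  have hlc : ‖(l * c : ℂ)‖ ^ q = x ^ p := by
    rw [norm_mul, hc, mul_one, norm_real, Real.norm_of_nonneg hl, hlq]
  have hr : ∀ r ∈ Set.Ioo (0 : ℝ) 1, (l * c * dualSum a m (fun z ↦ g (r * z))).re -
      x ^ p / q + κ * (1 / p - σ) ≤ M ^ p / p := by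
    rintro r ⟨hr0, hr1⟩
    have hd := diffContOnCl_dilation hg.1 hr0 hr1
    have h := hall (fun z ↦ (l * c) * g (r * z)) (hd.const_smul (l * c : ℂ))
    rw [dualSum_const_mul, circleAverage_norm_rpow_const_mul, hlc,
      circleAverage_norm_rpow_dilation] at h
    have h1 := hg.circleAverage_le hq hr0 hr1
    rw [hg1, Real.one_rpow] at h1
    have h2 := div_le_div_of_nonneg_right
      (mul_le_mul_of_nonneg_left h1 (Real.rpow_nonneg hx p)) hq.le
    rw [mul_one] at h2
    linarith
  have hlim : Filter.Tendsto (fun r : ℝ ↦ (l * c * dualSum a m (fun z ↦ g (r * z))).re -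
      x ^ p / q + κ * (1 / p - σ)) (nhdsWithin 1 (Set.Iio 1))
      (nhds ((l * c * dualSum a m g).re - x ^ p / q + κ * (1 / p - σ))) :=
    (((continuous_re.tendsto _).comp
      ((tendsto_dualSum_dilation had m hg.1).const_mul (l * c : ℂ))).sub_const _).add_const _
  have hfin := le_of_tendsto hlim
    (Filter.eventually_of_mem (Ioo_mem_nhdsLT zero_lt_one) hr)
  rw [mul_assoc, hcx, ← ofReal_mul, ofReal_re, hlx] at hfin
  have h4 : x ^ p - x ^ p / q = x ^ p / p := by
    have := hpq.inv_add_inv_eq_one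
    rw [div_eq_mul_inv, div_eq_mul_inv, eq_sub_of_add_eq' this]; ring
  rw [h4, le_div_iff₀ hp, add_mul, div_mul_cancel₀ _ hp.ne', mul_comm _ p] at hfin
  exact hfin

lemma sSup_dualValues_lt_succ {q : ℝ} (hq : 1 < q) {a : ℕ → ℂ} (ha : Function.Injective a)
    (had : ∀ k, ‖a k‖ < 1) (ha0 : ∀ k, a k ≠ 0) (m : ℕ) :
    sSup (dualValues q a m) < sSup (dualValues q a (m + 1)) := by
  have hpq := Real.HolderConjugate.conjExponent hq
  set p := q.conjExponent
  have hp := hpq.symm.pos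
  obtain ⟨δ, hδ, h⟩ := exists_rpow_add_le hpq ha had ha0 m
  set M := sSup (dualValues q a (m + 1))
  have hM : 0 ≤ M := sSup_dualValues_nonneg q a (m + 1)
  have hpos : ∀ x ∈ dualValues q a m, 0 ≤ x := fun _ ⟨_, _, _, h⟩ ↦ h ▸ norm_nonneg _
  have hne := dualValues_nonempty hq a m
  have hMδ : 0 ≤ M ^ p - δ := by
    obtain ⟨x, hx⟩ := hne
    have := h x hx
    have := Real.rpow_nonneg (hpos x hx) p
    linarith
  have hle : sSup (dualValues q a m) ≤ (M ^ p - δ) ^ p⁻¹ := csSup_le hne fun x hx ↦ by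
    rw [Real.le_rpow_inv_iff_of_pos (hpos x hx) hMδ hp]
    linarith [h x hx]
  refine hle.trans_lt ?_
  calc (M ^ p - δ) ^ p⁻¹ < (M ^ p) ^ p⁻¹ :=
        Real.rpow_lt_rpow hMδ (by linarith) (inv_pos.2 hp)
    _ = M := Real.rpow_rpow_inv hM hp.ne'

end

theorem corollary3p6 (q : ℝ) (hq : 1 < q) (a : ℕ → ℂ) (ha : Function.Injective a)
    (ha_disc : ∀ k, ‖a k‖ < 1) (ha_ne : ∀ k, a k ≠ 0) (m n : ℕ) (hmn : m < n) :
    BddAbove (dualValues q a m) ∧ BddAbove (dualValues q a n) ∧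
      sSup (dualValues q a m) < sSup (dualValues q a n) := by
  exact ⟨bddAbove_dualValues hq ha_disc m, bddAbove_dualValues hq ha_disc n,
    strictMono_nat_of_lt_succ (sSup_dualValues_lt_succ hq ha ha_disc ha_ne) hmn⟩
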